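/- Let $\mathbb{S}=(S,\eta,\mu)$ be a monad on the category $\mathbf{Set}$. The following three conditions are equivalent: (a) for every finitary monad $\mathbb{T}$ on $\mathbf{Set}$ (i.e. every monad whose underlying endofunctor preserves filtered colimits), the coproduct $\mathbb{S}\oplus\mathbb{T}$ exists in the category of monads on $\mathbf{Set}$ and monad morphisms; (b) a free monad on the functor $S$ exists, i.e. there are a monad $\mathbb{F}$ on $\mathbf{Set}$ with underlying functor $F$ and a natural transformation $\gamma\colon S\to F$ such that for every monad $\mathbb{M}$ on $\mathbf{Set}$ with underlying functor $M$ and every natural transformation $\lambda\colon S\to M$ there is a unique monad morphism $f\colon\mathbb{F}\to\mathbb{M}$ with $f\circ\gamma=\lambda$; (c) the coproduct $\mathbb{S}\oplus\mathbb{P}_f$ exists, where $\mathbb{P}_f$ is the finite power-set monad: $P_fX$ is the set of all finite subsets of $X$ (including $\emptyset$), functions act by direct image, the unit is $x\mapsto\{x\}$ and the multiplication is union. -/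

import Mathlib

open CategoryTheory CategoryTheory.Limits

universe v u

/-- The monad `F` together with the natural transformation `γ : H ⟶ F` is a free monad on the
endofunctor `H`: the pair `(F, γ)` is initial among all pairs consisting of a monad `M` and a
natural transformation from `H` to the underlying functor of `M`. -/
def IsFreeMonad {C : Type u} [Category.{v} C] (H : C ⥤ C) (F : CategoryTheory.Monad C)
    (γ : H ⟶ F.toFunctor) : Prop :=
  ∀ (M : CategoryTheory.Monad C) (l : H ⟶ M.toFunctor),
    ∃! f : F ⟶ M, γ ≫ (monadToFunctor C).map f = l

/-- A free monad on the endofunctor `H` exists. -/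
def HasFreeMonad {C : Type u} [Category.{v} C] (H : C ⥤ C) : Prop :=
  ∃ (F : CategoryTheory.Monad C) (γ : H ⟶ F.toFunctor), IsFreeMonad H F γ

/-- A monad is finitary if its underlying functor preserves (small) filtered colimits. -/
def IsFinitaryMonad (T : CategoryTheory.Monad (Type u)) : Prop :=
  PreservesFilteredColimits T.toFunctor

/-- The finite power-set monad: `X` is sent to the set of its finite subsets (the empty one
included), functions act by direct image, the unit forms singletons and the multiplication is
union. -/
def finitePowersetMonad : CategoryTheory.Monad (Type u) where
  obj X := {s : Set X // s.Finite}
  map f := TypeCat.ofHom fun s => ⟨f '' s.1, s.2.image f⟩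
  map_id X := by
    ext s x
    exact Set.ext_iff.mp (Set.image_id s.1) x
  map_comp f g := by
    ext s x
    exact Set.ext_iff.mp (Set.image_comp g f s.1) x
  η :=
    { app := fun X => TypeCat.ofHom fun x => ⟨{x}, Set.finite_singleton x⟩
      naturality := fun X Y f => by
        ext x y
        exact Set.ext_iff.mp (Set.image_singleton (f := f) (a := x)).symm y }
  μ :=
    { app := fun X => TypeCat.ofHom fun (A : {t : Set {s : Set X // s.Finite} // t.Finite}) =>
        ⟨⋃ s ∈ A.1, s.1, A.2.biUnion fun s _ => s.2⟩
      naturality := fun X Y f => by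
        ext A y
        refine Set.ext_iff.mp ?_ y
        change (⋃ s ∈ (fun s : {s : Set X // s.Finite} =>
            (⟨f '' s.1, s.2.image f⟩ : {s : Set Y // s.Finite})) '' A.1, s.1) =
          f '' ⋃ s ∈ A.1, s.1
        rw [Set.biUnion_image, Set.image_iUnion₂] }
  assoc X := by
    ext A x
    change (x ∈ ⋃ s ∈ (fun B : {t : Set {s : Set X // s.Finite} // t.Finite} =>
        (⟨⋃ s ∈ B.1, s.1, B.2.biUnion fun s _ => s.2⟩ : {s : Set X // s.Finite})) '' A.1, s.1) ↔
      x ∈ ⋃ s ∈ (⋃ B ∈ A.1, B.1), s.1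
    rw [Set.biUnion_image]
    simp only [Set.mem_iUnion, exists_prop]
    exact ⟨fun ⟨B, hB, s, hs, hx⟩ => ⟨s, ⟨B, hB, hs⟩, hx⟩,
      fun ⟨s, ⟨B, hB, hs⟩, hx⟩ => ⟨B, hB, s, hs, hx⟩⟩
  left_unit X := by
    ext s y
    refine Set.ext_iff.mp ?_ y
    change (⋃ t ∈ ({s} : Set {s : Set X // s.Finite}), t.1) = s.1
    rw [Set.biUnion_singleton]
  right_unit X := by
    ext s y
    refine Set.ext_iff.mp ?_ y
    change (⋃ t ∈ (fun x => (⟨{x}, Set.finite_singleton x⟩ : {s : Set X // s.Finite})) '' s.1,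
      t.1) = s.1
    rw [Set.biUnion_image]
    exact Set.biUnion_of_singleton s.1

/-! All three conditions are equivalent to a size condition on the functor `S`: above every set `Y`
there is a set `A` with an injection `Y ⊕ S A → A` (`HasLargePrefixedPoints`).

Sufficiency. Such an `A` bounds the size of some subalgebra around any `Y`-indexed family in any
algebra, so a set of test algebras suffices and free algebras exist in every class closed under
products and subalgebras (`nonempty_freeAlg`); they form a monad. The class of all `S`-algebras
gives the free monad. If `T` is finitary, the size condition passes to the functor `S + T`, and the
class of algebras obeying the Eilenberg–Moore laws for both monads gives the coproduct.

Necessity. Suppose no such `A` exists above an infinite `X`, and let `D` be well-ordered. At each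
stage `X + {d' < d}` the functor produces an element that is neither a unit nor used before, so `D`
is coded by distinct `q d` in `S (X + D)` (`exists_coding`). An algebra on `B` induces a map into
the continuation monad of `B`; hence a free monad or coproduct `R` yields a homomorphism from `R X`
to any algebra, with prescribed values on `X` (`exists_isAlgHom_of_contMonad`). For the free monad
the algebra is `X + D` with `q d ↦ d`; for the coproduct with the finite power-set monad it is `S (X
+ D)` with a semilattice order in which `k ∨ q d = η d`. In both, the elements of `X` generate a
copy of `D`, so `D` embeds into `R X`, which fails once `D` is chosen too large. -/

/-- The action of an endofunctor of `Type u` on a plain function. -/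
def fmap (H : Type u ⥤ Type u) {X Y : Type u} (f : X → Y) (z : H.obj X) : H.obj Y :=
  H.map (TypeCat.ofHom f) z

section fmap

variable (H : Type u ⥤ Type u) {X Y Z : Type u}

theorem fmap_id (z : H.obj X) : fmap H (id : X → X) z = z := by
  have : TypeCat.ofHom (id : X → X) = 𝟙 X := rfl
  simp [fmap, this]

theorem fmap_fmap (g : Y → Z) (f : X → Y) (z : H.obj X) :
    fmap H g (fmap H f z) = fmap H (g ∘ f) z := by
  have : TypeCat.ofHom (g ∘ f) = TypeCat.ofHom f ≫ TypeCat.ofHom g := rfl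
  simp [fmap, this]

/-- Injections with nonempty domain split, and every functor preserves splittings. Over an empty
domain this can fail, whence the nonemptiness assumptions later on. -/
theorem fmap_injective [Nonempty X] {f : X → Y} (hf : Function.Injective f) :
    Function.Injective (fmap H f) := by
  intro z w h
  have := congrArg (fmap H (Function.invFun f)) h
  simpa [fmap_fmap, Function.invFun_comp hf, fmap_id] using this

theorem fmap_surjective {f : X → Y} (hf : Function.Surjective f) :
    Function.Surjective (fmap H f) := by
  intro z
  obtain ⟨g, hg⟩ := hf.hasRightInverse
  exact ⟨fmap H g z, by rw [fmap_fmap, hg.comp_eq_id, fmap_id]⟩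

variable {H} in
theorem app_fmap {K : Type u ⥤ Type u} (α : H ⟶ K) (f : X → Y) (z : H.obj X) :
    α.app Y (fmap H f z) = fmap K f (α.app X z) :=
  NatTrans.naturality_apply α (TypeCat.ofHom f) z

end fmap

/-! ### Subalgebras and their size -/

/-- A subset of an algebra closed under the structure map. -/
def IsSubalgebra {H : Type u ⥤ Type u} {B : Type u} (b : H.obj B → B) (V : Set B) : Prop :=
  ∀ z : H.obj V, b (fmap H Subtype.val z) ∈ V

/-- Homomorphisms of algebras for an endofunctor. -/
def IsAlgHom {H : Type u ⥤ Type u} {B C : Type u} (b : H.obj B → B) (c : H.obj C → C)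
    (h : B → C) : Prop :=
  ∀ z, h (b z) = c (fmap H h z)

section algebra

variable {H : Type u ⥤ Type u}

theorem IsAlgHom.comp {B C D : Type u} {b : H.obj B → B} {c : H.obj C → C} {d : H.obj D → D}
    {g : C → D} {h : B → C} (hg : IsAlgHom c d g) (hh : IsAlgHom b c h) :
    IsAlgHom b d (g ∘ h) := fun z => by
  simp only [Function.comp_apply, hh z, hg _, fmap_fmap]

theorem IsAlgHom.id {B : Type u} (b : H.obj B → B) : IsAlgHom b b (id : B → B) := fun z => by
  simp [fmap_id]

theorem IsSubalgebra.mem_of_forall_mem {B : Type u} {b : H.obj B → B} {V : Set B}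
    (hV : IsSubalgebra b V) {Z : Type u} (f : Z → B) (hf : ∀ x, f x ∈ V) (z : H.obj Z) :
    b (fmap H f z) ∈ V := by
  have := hV (fmap H (fun x => (⟨f x, hf x⟩ : V)) z)
  rwa [fmap_fmap] at this

theorem IsAlgHom.isSubalgebra_range {B C : Type u} {b : H.obj B → B} {c : H.obj C → C}
    {h : B → C} (hh : IsAlgHom b c h) : IsSubalgebra c (Set.range h) := fun z => by
  obtain ⟨w, rfl⟩ := fmap_surjective H (Set.rangeFactorization_surjective (f := h)) z
  exact ⟨b w, by rw [hh, fmap_fmap]; rfl⟩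

/-- If `Y ⊕ H A` embeds into `A`, then every family of elements of an algebra indexed by `Y` lies
in a subalgebra that embeds into `A`. -/
theorem exists_small_subalgebra_of_nonempty {A B Y : Type u} [Nonempty Y] {j : Y ⊕ H.obj A → A}
    (hj : Function.Injective j) (b : H.obj B → B) (y : Y → B) :
    ∃ V : Set B, IsSubalgebra b V ∧ (∀ i, y i ∈ V) ∧ ∃ g : V → A, Function.Injective g := by
  let fst (G : Set (A × B)) : G → A := fun p => p.1.1
  let snd (G : Set (A × B)) : G → B := fun p => p.1.2
  -- One step of simultaneous generation in `A` (via `j`) and in `B` (via `b`). A fixed point whose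
  -- first projection is injective is a partial map from `A` to `B` with a subalgebra as image.
  let Φ (G : Set (A × B)) : Set (A × B) :=
    Set.range (fun i => (j (Sum.inl i), y i)) ∪
      Set.range (fun z : H.obj G => (j (Sum.inr (fmap H (fst G) z)), b (fmap H (snd G) z)))
  have hmono : ∀ G G', G ⊆ G' → Φ G ⊆ Φ G' := by
    rintro G G' h p (⟨i, rfl⟩ | ⟨z, rfl⟩)
    · exact Or.inl ⟨i, rfl⟩
    · refine Or.inr ⟨fmap H (Set.inclusion h) z, ?_⟩
      simp only [fmap_fmap]
      rfl
  let G₀ : Set (A × B) := Set.range (fun i => (j (Sum.inl i), y i))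
  let good : Set (Set (A × B)) := {G | G₀ ⊆ G ∧ G ⊆ Φ G ∧ Function.Injective (fst G)}
  have hG₀ : G₀ ∈ good := by
    refine ⟨subset_rfl, Set.subset_union_left, ?_⟩
    rintro ⟨_, i, rfl⟩ ⟨_, i', rfl⟩ h
    have : i = i' := Sum.inl_injective (hj h)
    subst this
    rfl
  have hchain : ∀ c ⊆ good, IsChain (· ⊆ ·) c → c.Nonempty →
      ∃ ub ∈ good, ∀ s ∈ c, s ⊆ ub := by
    intro c hc hcc ⟨G₁, hG₁⟩
    refine ⟨⋃₀ c, ⟨(hc hG₁).1.trans (Set.subset_sUnion_of_mem hG₁), ?_, ?_⟩,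
      fun s hs => Set.subset_sUnion_of_mem hs⟩
    · rintro p ⟨G, hG, hp⟩
      exact hmono _ _ (Set.subset_sUnion_of_mem hG) ((hc hG).2.1 hp)
    · rintro ⟨p, G, hG, hp⟩ ⟨p', G', hG', hp'⟩ h
      obtain ⟨K, hK, hpK, hpK'⟩ : ∃ K ∈ c, p ∈ K ∧ p' ∈ K := by
        rcases hcc.total hG hG' with h | h
        · exact ⟨G', hG', h hp, hp'⟩
        · exact ⟨G, hG, hp, h hp'⟩
      have := (hc hK).2.2 (a₁ := ⟨p, hpK⟩) (a₂ := ⟨p', hpK'⟩) h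
      exact Subtype.ext (Subtype.mk.inj this)
  obtain ⟨G, -, hG⟩ := zorn_subset_nonempty good hchain G₀ hG₀
  obtain ⟨⟨hG1, hG2, hG3⟩, hmax⟩ := hG
  have : Nonempty G := by
    obtain ⟨i⟩ := ‹Nonempty Y›
    exact ⟨⟨_, hG1 ⟨i, rfl⟩⟩⟩
  -- `Φ G` is again good: its first projection is injective because `j` is and because `H` preserves
  -- the injection `fst G`, `G` being nonempty. Maximality closes `G` under `Φ`.
  have hΦG : Φ G ⊆ G := by
    refine hmax ⟨Set.subset_union_left, hmono _ _ hG2, ?_⟩ hG2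
    rintro ⟨_, ⟨i, rfl⟩ | ⟨z, rfl⟩⟩ ⟨_, ⟨i', rfl⟩ | ⟨z', rfl⟩⟩ h
    · have : i = i' := Sum.inl_injective (hj h)
      subst this
      rfl
    · cases hj h
    · cases hj h
    · have : z = z' := fmap_injective H hG3 (Sum.inr_injective (hj h))
      subst this
      rfl
  refine ⟨Set.range (snd G), fun z => ?_, fun i => ⟨⟨_, hG1 ⟨i, rfl⟩⟩, rfl⟩, ?_⟩
  · obtain ⟨w, rfl⟩ := fmap_surjective H (Set.rangeFactorization_surjective (f := snd G)) z
    rw [fmap_fmap]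
    exact ⟨⟨_, hΦG (Or.inr ⟨w, rfl⟩)⟩, rfl⟩
  · obtain ⟨s, hs⟩ := (Set.rangeFactorization_surjective (f := snd G)).hasRightInverse
    exact ⟨fst G ∘ s, hG3.comp hs.injective⟩

theorem exists_small_subalgebra {A B X : Type u} {j : Option X ⊕ H.obj A → A}
    (hj : Function.Injective j) (b : H.obj B → B) (x : X → B) :
    ∃ V : Set B, IsSubalgebra b V ∧ (∀ i, x i ∈ V) ∧ ∃ g : V → A, Function.Injective g := by
  rcases isEmpty_or_nonempty B with hB | ⟨⟨b₀⟩⟩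
  · exact ⟨Set.univ, fun _ => trivial, fun _ => trivial, fun v => (hB.false v.1).elim,
      fun v => (hB.false v.1).elim⟩
  -- The point added to `X` is sent to an arbitrary `b₀`; it only keeps the index type nonempty.
  · obtain ⟨V, hV, hx, hg⟩ := exists_small_subalgebra_of_nonempty hj b (fun o => o.elim b₀ x)
    exact ⟨V, hV, fun i => hx (some i), hg⟩

end algebra

/-! ### Free algebras in a class of algebras -/

/-- `H` has arbitrarily large prefixed points, up to injections. -/
def HasLargePrefixedPoints (H : Type u ⥤ Type u) : Prop :=
  ∀ Y : Type u, ∃ (A : Type u) (j : Y ⊕ H.obj A → A), Function.Injective j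

/-- A class of `H`-algebras closed under products and subalgebras: an algebra with a jointly
injective family of homomorphisms to members of the class belongs to it. -/
def IsClosedUnderSubproducts {H : Type u ⥤ Type u} (P : ∀ B : Type u, (H.obj B → B) → Prop) :
    Prop :=
  ∀ {I B : Type u} (b : H.obj B → B) (C : I → Type u) (c : ∀ i, H.obj (C i) → C i)
    (g : ∀ i, B → C i), (∀ i, IsAlgHom b (c i) (g i)) →
    (∀ x y, (∀ i, g i x = g i y) → x = y) → (∀ i, P (C i) (c i)) → P B b

/-- A free algebra over `X` in the class `P` of `H`-algebras. -/
structure FreeAlg (H : Type u ⥤ Type u) (P : ∀ B : Type u, (H.obj B → B) → Prop)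
    (X : Type u) where
  /-- the carrier -/
  carrier : Type u
  /-- the structure map -/
  str : H.obj carrier → carrier
  /-- the insertion of generators -/
  unit : X → carrier
  prop : P carrier str
  exists_lift : ∀ {B : Type u} (b : H.obj B → B), P B b → ∀ x : X → B,
    ∃ h : carrier → B, IsAlgHom str b h ∧ h ∘ unit = x
  hom_ext : ∀ {B : Type u} {b : H.obj B → B}, ∀ {g h : carrier → B}, IsAlgHom str b g →
    IsAlgHom str b h → g ∘ unit = h ∘ unit → g = h

section free

variable {H : Type u ⥤ Type u} {P : ∀ B : Type u, (H.obj B → B) → Prop}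

/-- The structure map of a subalgebra. -/
def IsSubalgebra.str {B : Type u} {b : H.obj B → B} {V : Set B} (hV : IsSubalgebra b V) :
    H.obj V → V := fun z => ⟨_, hV z⟩

theorem IsSubalgebra.isAlgHom_val {B : Type u} {b : H.obj B → B} {V : Set B}
    (hV : IsSubalgebra b V) : IsAlgHom hV.str b (Subtype.val : V → B) := fun _ => rfl

theorem isSubalgebra_equalizer {B C : Type u} {b : H.obj B → B} {c : H.obj C → C} {g h : B → C}
    (hg : IsAlgHom b c g) (hh : IsAlgHom b c h) : IsSubalgebra b {x | g x = h x} := fun z => by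
  have : g ∘ (Subtype.val : {x | g x = h x} → B) = h ∘ Subtype.val := funext fun x => x.2
  change g _ = h _
  rw [hg, hh, fmap_fmap, fmap_fmap]
  exact congrArg (fun f => c (fmap H f z)) this

theorem isSubalgebra_sInter {B : Type u} {b : H.obj B → B} {s : Set (Set B)}
    (hs : ∀ V ∈ s, IsSubalgebra b V) : IsSubalgebra b (⋂₀ s) := fun z V hV =>
  (hs V hV).mem_of_forall_mem _ (fun x => x.2 V hV) z

theorem IsSubalgebra.image_val {B : Type u} {b : H.obj B → B} {V : Set B}
    (hV : IsSubalgebra b V) {W : Set V} (hW : IsSubalgebra hV.str W) :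
    IsSubalgebra b (Subtype.val '' W) := by
  have := (hV.isAlgHom_val.comp hW.isAlgHom_val).isSubalgebra_range
  rwa [Set.range_comp, Subtype.range_coe] at this

/-- Adjoint functor argument: the free algebra is the subalgebra generated by `X` in the product of
all members of the class carried by subsets of `A` and equipped with a map from `X`. -/
theorem nonempty_freeAlg (hP : IsClosedUnderSubproducts P) (hH : HasLargePrefixedPoints H)
    (X : Type u) : Nonempty (FreeAlg H P X) := by
  obtain ⟨A, j, hj⟩ := hH (Option X)
  let I : Type u := {i : (U : Set A) × (H.obj U → U) × (X → U) // P i.1 i.2.1}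
  let C : I → Type u := fun i => i.1.1
  let c : ∀ i, H.obj (C i) → C i := fun i => i.1.2.1
  let prod : H.obj (∀ i, C i) → ∀ i, C i := fun z i => c i (fmap H (fun f => f i) z)
  have hprod : ∀ i, IsAlgHom prod (c i) (fun f => f i) := fun i z => rfl
  let e : X → ∀ i, C i := fun x i => i.1.2.2 x
  let V : Set (∀ i, C i) := ⋂₀ {V | IsSubalgebra prod V ∧ ∀ x, e x ∈ V}
  have hV : IsSubalgebra prod V := isSubalgebra_sInter fun V h => h.1
  have hproj : ∀ i, IsAlgHom hV.str (c i) (fun v => v.1 i) := fun i =>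
    (hprod i).comp hV.isAlgHom_val
  refine ⟨⟨V, hV.str, fun x => ⟨e x, fun W h => h.2 x⟩, ?_, ?_, ?_⟩⟩
  · exact hP _ C c (fun i v => v.1 i) hproj (fun v w h => Subtype.ext (funext h)) fun i => i.2
  · intro B b hb x
    obtain ⟨W, hW, hx, g, hg⟩ := exists_small_subalgebra hj b x
    -- The small subalgebra is transported to a subset of `A`, where it becomes one of the factors
    -- of the product.
    let E : W ≃ Set.range g := Equiv.ofInjective g hg
    let r : H.obj (Set.range g) → Set.range g := fun z => E (hW.str (fmap H E.symm z))
    have hEr : IsAlgHom r b (Subtype.val ∘ E.symm) := fun z => by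
      simp only [Function.comp_apply, r, Equiv.symm_apply_apply]
      rw [hW.isAlgHom_val, fmap_fmap]
    have hr : P (Set.range g) r := hP (I := PUnit) r (fun _ => B) (fun _ => b)
      (fun _ => Subtype.val ∘ E.symm) (fun _ => hEr)
      (fun x y h => (Subtype.val_injective.comp E.symm.injective) (h ⟨⟩)) (fun _ => hb)
    let i : I := ⟨⟨Set.range g, r, fun t => E ⟨x t, hx t⟩⟩, hr⟩
    refine ⟨_, hEr.comp (hproj i), ?_⟩
    funext t
    change (E.symm (E ⟨x t, hx t⟩)).1 = x t
    rw [Equiv.symm_apply_apply]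
  · intro B b g h hg hh hgh
    -- The equalizer of `g` and `h` contains the generators, and `V` is the least such subalgebra.
    have h1 : V ⊆ Subtype.val '' {v | g v = h v} := Set.sInter_subset_of_mem
      ⟨hV.image_val (isSubalgebra_equalizer hg hh),
        fun x => ⟨⟨e x, fun W h => h.2 x⟩, congrFun hgh x, rfl⟩⟩
    funext v
    obtain ⟨w, hw, hwv⟩ := h1 v.2
    rwa [Subtype.ext hwv] at hw

end free

/-! ### Monad laws on elements and induced algebras -/

/-- The algebra structure on `M X` induced by a natural transformation into a monad `M`. -/
def inducedStr {H : Type u ⥤ Type u} {M : CategoryTheory.Monad (Type u)} (l : H ⟶ M.toFunctor)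
    (X : Type u) (z : H.obj (M.obj X)) : M.obj X :=
  M.μ.app X (l.app (M.obj X) z)

section monadLaws

variable (M : CategoryTheory.Monad (Type u)) {X Y : Type u}

theorem eta_fmap (f : X → Y) (x : X) :
    fmap M.toFunctor f (M.η.app X x) = M.η.app Y (f x) :=
  (NatTrans.naturality_apply M.η (TypeCat.ofHom f) x).symm

theorem mu_fmap (f : X → Y) (z : M.obj (M.obj X)) :
    M.μ.app Y (fmap M.toFunctor (fmap M.toFunctor f) z) =
      fmap M.toFunctor f (M.μ.app X z) :=
  NatTrans.naturality_apply M.μ (TypeCat.ofHom f) z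

theorem mu_eta (z : M.obj X) : M.μ.app X (M.η.app (M.obj X) z) = z :=
  ConcreteCategory.congr_hom (M.left_unit X) z

theorem mu_fmap_eta (z : M.obj X) : M.μ.app X (fmap M.toFunctor (M.η.app X) z) = z :=
  ConcreteCategory.congr_hom (M.right_unit X) z

theorem mu_assoc (z : M.obj (M.obj (M.obj X))) :
    M.μ.app X (fmap M.toFunctor (M.μ.app X) z) = M.μ.app X (M.μ.app (M.obj X) z) :=
  ConcreteCategory.congr_hom (M.assoc X) z

variable {M} {N : CategoryTheory.Monad (Type u)} (f : M ⟶ N)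

theorem monadHom_eta (x : X) : f.app X (M.η.app X x) = N.η.app X x :=
  ConcreteCategory.congr_hom (f.app_η X) x

theorem monadHom_mu (z : M.obj (M.obj X)) :
    f.app X (M.μ.app X z) = N.μ.app X (f.app _ (fmap M.toFunctor (f.app X) z)) :=
  ConcreteCategory.congr_hom (f.app_μ X) z

theorem monadHom_fmap (g : X → Y) (z : M.obj X) :
    f.app Y (fmap M.toFunctor g z) = fmap N.toFunctor g (f.app X z) :=
  app_fmap f.toNatTrans g z

theorem inducedStr_isAlgHom_fmap {H : Type u ⥤ Type u} (l : H ⟶ M.toFunctor) (g : X → Y) :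
    IsAlgHom (inducedStr l X) (inducedStr l Y) (fmap M.toFunctor g) := fun z => by
  simp only [inducedStr, app_fmap, mu_fmap]

theorem inducedStr_isAlgHom_mu {H : Type u ⥤ Type u} (l : H ⟶ M.toFunctor) (X : Type u) :
    IsAlgHom (inducedStr l (M.obj X)) (inducedStr l X) (M.μ.app X) := fun z => by
  simp only [inducedStr, app_fmap]
  exact (mu_assoc M _).symm

theorem inducedStr_isAlgHom_monadHom {H : Type u ⥤ Type u} {l : H ⟶ M.toFunctor}
    {l' : H ⟶ N.toFunctor} (hl : l ≫ (monadToFunctor (Type u)).map f = l') (X : Type u) :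
    IsAlgHom (inducedStr l X) (inducedStr l' X) (f.app X) := fun z => by
  subst hl
  simp only [inducedStr, monadHom_mu, monadHom_fmap]
  change _ = N.μ.app X (f.app (N.obj X) (l.app (N.obj X) (fmap H (f.app X) z)))
  rw [app_fmap, monadHom_fmap]

end monadLaws

/-! ### The monad of free algebras and its universal property -/

section universalMonad

variable {H : Type u ⥤ Type u} {P : ∀ B : Type u, (H.obj B → B) → Prop}
  (F : ∀ X : Type u, FreeAlg H P X)

/-- The homomorphism out of a free algebra extending a function. -/
noncomputable def FreeAlg.lift {X : Type u} (F : FreeAlg H P X) {B : Type u} (b : H.obj B → B)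
    (hb : P B b) (x : X → B) : F.carrier → B :=
  (F.exists_lift b hb x).choose

theorem FreeAlg.lift_isAlgHom {X : Type u} (F : FreeAlg H P X) {B : Type u} (b : H.obj B → B)
    (hb : P B b) (x : X → B) : IsAlgHom F.str b (F.lift b hb x) :=
  (F.exists_lift b hb x).choose_spec.1

theorem FreeAlg.lift_unit {X : Type u} (F : FreeAlg H P X) {B : Type u} (b : H.obj B → B)
    (hb : P B b) (x : X → B) (t : X) : F.lift b hb x (F.unit t) = x t :=
  congrFun (F.exists_lift b hb x).choose_spec.2 t

theorem FreeAlg.hom_ext_apply {X : Type u} (F : FreeAlg H P X) {B : Type u} {b : H.obj B → B}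
    {g h : F.carrier → B} (hg : IsAlgHom F.str b g) (hh : IsAlgHom F.str b h)
    (H : ∀ x, g (F.unit x) = h (F.unit x)) (t : F.carrier) : g t = h t :=
  congrFun (F.hom_ext hg hh (funext H)) t

/-- The action of the free algebra construction on functions. -/
noncomputable def FreeAlg.map {X Y : Type u} (f : X → Y) : (F X).carrier → (F Y).carrier :=
  (F X).lift (F Y).str (F Y).prop ((F Y).unit ∘ f)

/-- The multiplication of the monad of free algebras. -/
noncomputable def FreeAlg.join (X : Type u) : (F (F X).carrier).carrier → (F X).carrier :=
  (F _).lift (F X).str (F X).prop id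

theorem FreeAlg.map_isAlgHom {X Y : Type u} (f : X → Y) :
    IsAlgHom (F X).str (F Y).str (FreeAlg.map F f) :=
  FreeAlg.lift_isAlgHom _ _ _ _

theorem FreeAlg.map_unit {X Y : Type u} (f : X → Y) (x : X) :
    FreeAlg.map F f ((F X).unit x) = (F Y).unit (f x) :=
  FreeAlg.lift_unit _ _ _ _ _

theorem FreeAlg.join_isAlgHom (X : Type u) :
    IsAlgHom (F (F X).carrier).str (F X).str (FreeAlg.join F X) :=
  FreeAlg.lift_isAlgHom _ _ _ _

theorem FreeAlg.join_unit (X : Type u) (t : (F X).carrier) :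
    FreeAlg.join F X ((F _).unit t) = t :=
  FreeAlg.lift_unit _ _ _ _ _

/-- The monad of free algebras. -/
noncomputable def freeAlgMonad : CategoryTheory.Monad (Type u) where
  obj X := (F X).carrier
  map f := TypeCat.ofHom (FreeAlg.map F f)
  map_id X := by
    ext t
    exact (F X).hom_ext_apply (FreeAlg.map_isAlgHom F _) (IsAlgHom.id _)
      (fun x => FreeAlg.map_unit F _ x) t
  map_comp {X Y Z} f g := by
    ext t
    refine (F X).hom_ext_apply (FreeAlg.map_isAlgHom F _)
      ((FreeAlg.map_isAlgHom F _).comp (FreeAlg.map_isAlgHom F _)) (fun x => ?_) t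
    simp only [Function.comp_apply, FreeAlg.map_unit]
    rfl
  η :=
    { app := fun X => TypeCat.ofHom (F X).unit
      naturality := fun X Y f => by
        ext x
        exact (FreeAlg.map_unit F f x).symm }
  μ :=
    { app := fun X => TypeCat.ofHom (FreeAlg.join F X)
      naturality := fun X Y f => by
        ext t
        refine (F _).hom_ext_apply ((FreeAlg.join_isAlgHom F _).comp (FreeAlg.map_isAlgHom F _))
          ((FreeAlg.map_isAlgHom F _).comp (FreeAlg.join_isAlgHom F _)) (fun x => ?_) t
        simp only [Function.comp_apply, FreeAlg.map_unit, FreeAlg.join_unit]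
        rfl }
  assoc X := by
    ext t
    refine (F _).hom_ext_apply ((FreeAlg.join_isAlgHom F _).comp (FreeAlg.map_isAlgHom F _))
      ((FreeAlg.join_isAlgHom F _).comp (FreeAlg.join_isAlgHom F _)) (fun x => ?_) t
    simp only [Function.comp_apply, FreeAlg.map_unit, FreeAlg.join_unit]
    rfl
  left_unit X := by
    ext t
    exact FreeAlg.join_unit F X t
  right_unit X := by
    ext t
    refine (F _).hom_ext_apply ((FreeAlg.join_isAlgHom F _).comp (FreeAlg.map_isAlgHom F _))
      (IsAlgHom.id _) (fun x => ?_) t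
    simp only [Function.comp_apply, FreeAlg.map_unit]
    exact FreeAlg.join_unit F X _

/-- The canonical natural transformation into the monad of free algebras. -/
noncomputable def freeAlgInsertion : H ⟶ (freeAlgMonad F).toFunctor where
  app X := TypeCat.ofHom fun z => (F X).str (fmap H (F X).unit z)
  naturality X Y f := by
    ext z
    change (F Y).str (fmap H (F Y).unit (fmap H f z)) =
      FreeAlg.map F f ((F X).str (fmap H (F X).unit z))
    rw [FreeAlg.map_isAlgHom, fmap_fmap, fmap_fmap]
    congr 2
    funext x
    exact (FreeAlg.map_unit F f x).symm

theorem inducedStr_freeAlgInsertion (X : Type u) :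
    inducedStr (freeAlgInsertion F) X = (F X).str := by
  funext (z : H.obj (F X).carrier)
  change FreeAlg.join F X ((F _).str (fmap H (F _).unit z)) = _
  rw [FreeAlg.join_isAlgHom, fmap_fmap]
  have : FreeAlg.join F X ∘ (F _).unit = id := funext fun t => FreeAlg.join_unit F X t
  rw [this, fmap_id]

/-- The monad morphism out of the monad of free algebras induced by a natural transformation. -/
noncomputable def freeAlgMonadDesc {M : CategoryTheory.Monad (Type u)} (l : H ⟶ M.toFunctor)
    (hl : ∀ X, P (M.obj X) (inducedStr l X)) : freeAlgMonad F ⟶ M where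
  app X := TypeCat.ofHom ((F X).lift _ (hl X) (M.η.app X))
  naturality X Y f := by
    ext t
    refine (F X).hom_ext_apply ((FreeAlg.lift_isAlgHom (F Y) _ (hl Y) _).comp
      (FreeAlg.map_isAlgHom F f))
      ((inducedStr_isAlgHom_fmap l f).comp (FreeAlg.lift_isAlgHom (F X) _ (hl X) _))
      (fun x => ?_) t
    simp only [Function.comp_apply, FreeAlg.map_unit, FreeAlg.lift_unit]
    exact (eta_fmap M f x).symm
  app_η X := by
    ext x
    exact FreeAlg.lift_unit (F X) _ (hl X) _ x
  app_μ X := by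
    ext t
    refine (F _).hom_ext_apply
      ((FreeAlg.lift_isAlgHom (F X) _ (hl X) _).comp (FreeAlg.join_isAlgHom F _))
      ((inducedStr_isAlgHom_mu l X).comp ((FreeAlg.lift_isAlgHom (F _) _ (hl _) _).comp
        (FreeAlg.map_isAlgHom F _))) (fun x => ?_) t
    let φ : (F X).carrier → M.obj X := (F X).lift _ (hl X) (M.η.app X)
    change φ (FreeAlg.join F X ((F _).unit x)) =
      M.μ.app X ((F _).lift _ (hl _) _ (FreeAlg.map F φ ((F _).unit x)))
    rw [FreeAlg.join_unit, FreeAlg.map_unit, FreeAlg.lift_unit (F (M.obj X)), mu_eta]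

/-- Each component of a monad morphism compatible with `l` is a homomorphism into the induced
algebra that sends generators to units, hence is determined by freeness. -/
theorem freeAlgMonad_universal {M : CategoryTheory.Monad (Type u)} (l : H ⟶ M.toFunctor)
    (hl : ∀ X, P (M.obj X) (inducedStr l X)) :
    ∃! f : freeAlgMonad F ⟶ M,
      freeAlgInsertion F ≫ (monadToFunctor (Type u)).map f = l := by
  refine ⟨freeAlgMonadDesc F l hl, ?_, fun f hf => ?_⟩
  · ext X z
    change (F X).lift _ (hl X) (M.η.app X) ((F X).str (fmap H (F X).unit z)) = l.app X z
    rw [FreeAlg.lift_isAlgHom, fmap_fmap]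
    have : (F X).lift _ (hl X) (M.η.app X) ∘ (F X).unit = M.η.app X :=
      funext fun t => FreeAlg.lift_unit _ _ _ _ _
    rw [this, inducedStr, app_fmap, mu_fmap_eta]
  · ext X t
    have h := inducedStr_isAlgHom_monadHom f hf X
    rw [inducedStr_freeAlgInsertion] at h
    refine (F X).hom_ext_apply h (FreeAlg.lift_isAlgHom _ _ (hl X) _) (fun x => ?_) t
    rw [FreeAlg.lift_unit]
    exact monadHom_eta f x

end universalMonad

theorem HasLargePrefixedPoints.hasFreeMonad {H : Type u ⥤ Type u}
    (hH : HasLargePrefixedPoints H) : HasFreeMonad H := by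
  let P : ∀ B : Type u, (H.obj B → B) → Prop := fun _ _ => True
  have hP : IsClosedUnderSubproducts P := fun _ _ _ _ _ _ _ => trivial
  let F : ∀ X, FreeAlg H P X := fun X => (nonempty_freeAlg hP hH X).some
  exact ⟨freeAlgMonad F, freeAlgInsertion F, fun M l =>
    freeAlgMonad_universal F l fun _ => trivial⟩

/-! ### Coproducts of monads from free bialgebras -/

/-- The laws of an Eilenberg–Moore algebra. -/
def IsMonadAlg (M : CategoryTheory.Monad (Type u)) {B : Type u} (b : M.obj B → B) : Prop :=
  (∀ x, b (M.η.app B x) = x) ∧ ∀ z, b (M.μ.app B z) = b (fmap M.toFunctor b z)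

theorem isMonadAlg_of_jointly_injective (M : CategoryTheory.Monad (Type u)) {I B : Type u}
    (b : M.obj B → B) (C : I → Type u) (c : ∀ i, M.obj (C i) → C i) (g : ∀ i, B → C i)
    (hg : ∀ i z, g i (b z) = c i (fmap M.toFunctor (g i) z))
    (hinj : ∀ x y, (∀ i, g i x = g i y) → x = y) (hc : ∀ i, IsMonadAlg M (c i)) :
    IsMonadAlg M b := by
  refine ⟨fun x => hinj _ _ fun i => ?_, fun z => hinj _ _ fun i => ?_⟩
  · rw [hg, eta_fmap, (hc i).1]
  · have h : g i ∘ b = c i ∘ fmap M.toFunctor (g i) := funext (hg i)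
    rw [hg, hg, ← mu_fmap, (hc i).2, fmap_fmap, fmap_fmap, h]

theorem isMonadAlg_inducedStr {M N : CategoryTheory.Monad (Type u)} (f : M ⟶ N) (X : Type u) :
    IsMonadAlg M (inducedStr ((monadToFunctor (Type u)).map f) X) := by
  refine ⟨fun x => ?_, fun z => ?_⟩
  · change N.μ.app X (f.app _ (M.η.app _ x)) = x
    rw [monadHom_eta, mu_eta]
  · change N.μ.app X (f.app _ (M.μ.app _ z)) =
      N.μ.app X (f.app _ (fmap M.toFunctor (N.μ.app X ∘ f.app (N.obj X)) z))
    rw [monadHom_mu, ← fmap_fmap, monadHom_fmap _ (N.μ.app X), mu_assoc]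

/-- A natural transformation into a monad `N` that induces Eilenberg–Moore algebras is a monad
morphism. -/
def monadHomOfIsMonadAlg {M N : CategoryTheory.Monad (Type u)} (l : M.toFunctor ⟶ N.toFunctor)
    (hl : ∀ X, IsMonadAlg M (inducedStr l X)) : M ⟶ N where
  toNatTrans := l
  app_η X := by
    ext x
    have := (hl X).1 (N.η.app X x)
    rwa [← eta_fmap, inducedStr, app_fmap, mu_fmap_eta] at this
  app_μ X := by
    ext z
    -- Inserting units on the inside turns the induced structure back into `l`, so the algebra law
    -- becomes compatibility with multiplication.
    have := (hl X).2 (fmap M.toFunctor (fmap M.toFunctor (N.η.app X)) z)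
    rw [mu_fmap, inducedStr, app_fmap, mu_fmap_eta, fmap_fmap] at this
    have h : inducedStr l X ∘ fmap M.toFunctor (N.η.app X) = l.app X := funext fun w => by
      simp only [Function.comp_apply, inducedStr, app_fmap, mu_fmap_eta]
      rfl
    rw [h] at this
    exact this

/-- The pointwise disjoint sum of two endofunctors of `Type u`. -/
def sumFunctor (H K : Type u ⥤ Type u) : Type u ⥤ Type u where
  obj X := H.obj X ⊕ K.obj X
  map f := TypeCat.ofHom (Sum.map (H.map f) (K.map f))
  map_id X := by
    ext (z | z) <;> simp
  map_comp f g := by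
    ext (z | z) <;> simp

/-- The copairing of natural transformations. -/
def sumDesc {H K L : Type u ⥤ Type u} (l : H ⟶ L) (r : K ⟶ L) : sumFunctor H K ⟶ L where
  app X := TypeCat.ofHom (Sum.elim (l.app X) (r.app X))
  naturality X Y f := by
    ext (z | z)
    · exact NatTrans.naturality_apply l f z
    · exact NatTrans.naturality_apply r f z

/-- The left inclusion into a sum of endofunctors. -/
def sumInl (H K : Type u ⥤ Type u) : H ⟶ sumFunctor H K where
  app X := TypeCat.ofHom Sum.inl

/-- The right inclusion into a sum of endofunctors. -/
def sumInr (H K : Type u ⥤ Type u) : K ⟶ sumFunctor H K where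
  app X := TypeCat.ofHom Sum.inr

theorem hasBinaryCoproduct_of_hasLargePrefixedPoints (S T : CategoryTheory.Monad (Type u))
    (h : HasLargePrefixedPoints (sumFunctor S.toFunctor T.toFunctor)) :
    HasBinaryCoproduct S T := by
  let P : ∀ B : Type u, ((sumFunctor S.toFunctor T.toFunctor).obj B → B) → Prop := fun B b =>
    IsMonadAlg S (fun z : S.obj B => b (Sum.inl z)) ∧
      IsMonadAlg T (fun z : T.obj B => b (Sum.inr z))
  have hP : IsClosedUnderSubproducts P := fun b C c g hg hinj hc =>
    ⟨isMonadAlg_of_jointly_injective S _ C (fun i z => c i (Sum.inl z)) g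
        (fun i z => hg i (Sum.inl z)) hinj fun i => (hc i).1,
      isMonadAlg_of_jointly_injective T _ C (fun i z => c i (Sum.inr z)) g
        (fun i z => hg i (Sum.inr z)) hinj fun i => (hc i).2⟩
  let F : ∀ X, FreeAlg _ P X := fun X => (nonempty_freeAlg hP h X).some
  have hF : ∀ X, P _ (inducedStr (freeAlgInsertion F) X) := fun X => by
    rw [inducedStr_freeAlgInsertion]
    exact (F X).prop
  let inl : S ⟶ freeAlgMonad F :=
    monadHomOfIsMonadAlg (sumInl _ _ ≫ freeAlgInsertion F) fun X => (hF X).1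
  let inr : T ⟶ freeAlgMonad F :=
    monadHomOfIsMonadAlg (sumInr _ _ ≫ freeAlgInsertion F) fun X => (hF X).2
  -- A cocone under `S` and `T` is a transformation out of the sum functor, so the universal
  -- property of the free algebra monad applies.
  have key : ∀ {M : CategoryTheory.Monad (Type u)} (f : S ⟶ M) (g : T ⟶ M)
      (m : freeAlgMonad F ⟶ M), (inl ≫ m = f ∧ inr ≫ m = g) ↔
        freeAlgInsertion F ≫ (monadToFunctor (Type u)).map m =
          sumDesc ((monadToFunctor (Type u)).map f) ((monadToFunctor (Type u)).map g) := by
    intro M f g m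
    constructor
    · rintro ⟨rfl, rfl⟩
      ext X (z | z) <;> rfl
    · intro h
      have h' : ∀ X (w : (sumFunctor S.toFunctor T.toFunctor).obj X), _ := fun X w =>
        ConcreteCategory.congr_hom (NatTrans.congr_app h X) w
      exact ⟨by ext X z; exact h' X (Sum.inl z), by ext X z; exact h' X (Sum.inr z)⟩
  have huniv : ∀ {M : CategoryTheory.Monad (Type u)} (f : S ⟶ M) (g : T ⟶ M),
      ∃! m : freeAlgMonad F ⟶ M, inl ≫ m = f ∧ inr ≫ m = g := by
    intro M f g
    obtain ⟨m, hm, hm'⟩ := freeAlgMonad_universal F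
      (sumDesc ((monadToFunctor (Type u)).map f) ((monadToFunctor (Type u)).map g))
      fun X => ⟨isMonadAlg_inducedStr f X, isMonadAlg_inducedStr g X⟩
    exact ⟨m, (key f g m).2 hm, fun m' h => hm' m' ((key f g m').1 h)⟩
  exact HasColimit.mk ⟨BinaryCofan.mk inl inr, BinaryCofan.isColimitMk
    (fun s => (huniv s.inl s.inr).choose)
    (fun s => (huniv s.inl s.inr).choose_spec.1.1)
    (fun s => (huniv s.inl s.inr).choose_spec.1.2)
    (fun s m h₁ h₂ => (huniv s.inl s.inr).choose_spec.2 m ⟨h₁, h₂⟩)⟩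

/-! ### Cardinality bounds for finitary functors -/

section finitary

/-- The directed diagram of finite subsets of a type. -/
def finsetDiagram (A : Type u) : Finset A ⥤ Type u where
  obj s := {x // x ∈ s}
  map h := TypeCat.ofHom fun x => ⟨x.1, leOfHom h x.2⟩

/-- The cocone exhibiting a type as the union of its finite subsets. -/
def finsetCocone (A : Type u) : Cocone (finsetDiagram A) where
  pt := A
  ι := { app := fun s => TypeCat.ofHom fun x : {x // x ∈ s} => x.1 }

/-- A type is the directed colimit of its finite subsets. -/
noncomputable def finsetCoconeIsColimit (A : Type u) : IsColimit (finsetCocone A) := by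
  classical
  refine Types.FilteredColimit.isColimitOf' _ _ (fun x => ?_) fun s x y h => ?_
  · exact ⟨{x}, ⟨x, Finset.mem_singleton_self x⟩, rfl⟩
  · exact ⟨s, 𝟙 s, congrArg _ (Subtype.ext h)⟩

variable {T : Type u ⥤ Type u}

theorem exists_finset_support [PreservesFilteredColimits T] {A : Type u} (w : T.obj A) :
    ∃ (s : Finset A) (z : T.obj {x // x ∈ s}), fmap T Subtype.val z = w := by
  classical
  exact Types.jointly_surjective_of_isColimit
    (isColimitOfPreserves T (finsetCoconeIsColimit A)) w

theorem mk_obj_le_of_preservesFilteredColimits [PreservesFilteredColimits T] {A : Type u}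
    [Infinite A] (hA : Cardinal.mk (T.obj (ULift.{u} ℕ)) ≤ Cardinal.mk A) :
    Cardinal.mk (T.obj A) ≤ Cardinal.mk A := by
  classical
  obtain ⟨a₀⟩ : Nonempty A := inferInstance
  -- A finitely supported element is coded by a list of its support and an element of `T ℕ` on the
  -- list positions; the default `a₀` is never met on those positions.
  let φ : T.obj (ULift.{u} ℕ) × List A → T.obj A := fun p =>
    fmap T (fun n => p.2.getD n.down a₀) p.1
  have hφ : Function.Surjective φ := by
    intro w
    obtain ⟨s, z, rfl⟩ := exists_finset_support w
    refine ⟨(fmap T (fun x => ULift.up (s.toList.idxOf x.1)) z, s.toList), ?_⟩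
    simp only [φ, fmap_fmap]
    congr 1
    funext x
    simp
  calc Cardinal.mk (T.obj A) ≤ Cardinal.mk (T.obj (ULift.{u} ℕ) × List A) :=
        Cardinal.mk_le_of_surjective hφ
    _ ≤ Cardinal.mk A * Cardinal.mk A := by
        rw [Cardinal.mk_prod, Cardinal.lift_id, Cardinal.lift_id, Cardinal.mk_list_eq_mk]
        gcongr
    _ = Cardinal.mk A := Cardinal.mul_eq_self (Cardinal.aleph0_le_mk A)

theorem HasLargePrefixedPoints.sumFunctor_of_preservesFilteredColimits {H : Type u ⥤ Type u}
    (hH : HasLargePrefixedPoints H) (T : Type u ⥤ Type u) [PreservesFilteredColimits T] :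
    HasLargePrefixedPoints (sumFunctor H T) := by
  intro Y
  -- The extra summands make `A` infinite and at least as large as `T ℕ`, so that `T A` is no larger
  -- than `A`.
  obtain ⟨A, j, hj⟩ := hH (Y ⊕ T.obj (ULift.{u} ℕ) ⊕ ULift.{u} ℕ)
  have hY : Cardinal.mk Y ≤ Cardinal.mk A :=
    Cardinal.mk_le_of_injective ((hj.comp Sum.inl_injective).comp Sum.inl_injective)
  have hT : Cardinal.mk (T.obj (ULift.{u} ℕ)) ≤ Cardinal.mk A := Cardinal.mk_le_of_injective
    (((hj.comp Sum.inl_injective).comp Sum.inr_injective).comp Sum.inl_injective)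
  have hS : Cardinal.mk (H.obj A) ≤ Cardinal.mk A :=
    Cardinal.mk_le_of_injective (hj.comp Sum.inr_injective)
  have : Infinite A := Infinite.of_injective _
    (((hj.comp Sum.inl_injective).comp Sum.inr_injective).comp Sum.inr_injective)
  have hA := Cardinal.aleph0_le_mk A
  have h : Cardinal.mk (Y ⊕ (H.obj A ⊕ T.obj A)) ≤ Cardinal.mk A := by
    simp only [Cardinal.mk_sum, Cardinal.lift_id]
    exact Cardinal.add_le_of_le hA hY
      (Cardinal.add_le_of_le hA hS (mk_obj_le_of_preservesFilteredColimits hT))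
  obtain ⟨g⟩ := h
  exact ⟨A, g, g.injective⟩

end finitary

/-! ### The finite power-set monad is finitary -/

section finitePowerset

/-- In a filtered diagram, an inclusion between images of finite sets in the colimit holds at some
stage. -/
theorem exists_image_subset_image {J : Type u} [Category.{u} J] [IsFiltered J] {F : J ⥤ Type u}
    {c : Cocone F} (hc : IsColimit c) {i : J} {s t : Set (F.obj i)} (hs : s.Finite)
    (h : c.ι.app i '' s ⊆ c.ι.app i '' t) : ∃ (k : J) (f : i ⟶ k), F.map f '' s ⊆ F.map f '' t := by
  induction s, hs using Set.Finite.induction_on with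
  | empty => exact ⟨i, 𝟙 i, by simp⟩
  | @insert a s _ _ ih =>
    obtain ⟨k, f, hf⟩ := ih ((Set.image_mono (Set.subset_insert a s)).trans h)
    obtain ⟨b, hb, hab⟩ := h ⟨a, Set.mem_insert a s, rfl⟩
    obtain ⟨k', f', hf'⟩ := (Types.FilteredColimit.isColimit_eq_iff' hc b a).1 hab
    -- The arrows that settle `s` and `a` may differ even after reaching a common target;
    -- coequalizing them makes one arrow serve both.
    refine ⟨IsFiltered.coeq (f ≫ IsFiltered.leftToMax k k') (f' ≫ IsFiltered.rightToMax k k'),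
      (f ≫ IsFiltered.leftToMax k k') ≫ IsFiltered.coeqHom _ _, ?_⟩
    rintro _ ⟨x, rfl | hx, rfl⟩
    · refine ⟨b, hb, ?_⟩
      rw [IsFiltered.coeq_condition]
      simp [hf']
    · obtain ⟨y, hy, hxy⟩ := hf ⟨x, hx, rfl⟩
      exact ⟨y, hy, by simp [hxy]⟩

theorem exists_finite_image_eq {J : Type u} [Category.{u} J] [IsFiltered J] {F : J ⥤ Type u}
    {c : Cocone F} (hc : IsColimit c) {s : Set c.pt} (hs : s.Finite) :
    ∃ (i : J) (t : Set (F.obj i)), t.Finite ∧ c.ι.app i '' t = s := by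
  induction s, hs using Set.Finite.induction_on with
  | empty =>
    obtain ⟨i⟩ := IsFiltered.nonempty (C := J)
    exact ⟨i, ∅, Set.finite_empty, Set.image_empty _⟩
  | @insert a s _ _ ih =>
    obtain ⟨i, t, ht, rfl⟩ := ih
    obtain ⟨j, b, rfl⟩ := Types.jointly_surjective_of_isColimit hc a
    have hw : ∀ {i j : J} (f : i ⟶ j) (x : F.obj i), c.ι.app j (F.map f x) = c.ι.app i x :=
      fun f x => ConcreteCategory.congr_hom (c.w f) x
    refine ⟨IsFiltered.max i j, insert (F.map (IsFiltered.rightToMax i j) b)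
      (F.map (IsFiltered.leftToMax i j) '' t), (ht.image _).insert _, ?_⟩
    rw [Set.image_insert_eq, Set.image_image]
    simp only [hw]

theorem isFinitaryMonad_finitePowersetMonad : IsFinitaryMonad finitePowersetMonad.{u} := by
  refine ⟨fun J _ _ => ⟨fun {F} => ⟨fun {c} hc => ⟨?_⟩⟩⟩⟩
  refine Types.FilteredColimit.isColimitOf' _ _ (fun s => ?_) fun i s t h => ?_
  · obtain ⟨i, t, ht, h⟩ := exists_finite_image_eq hc s.2
    exact ⟨i, ⟨t, ht⟩, Subtype.ext h.symm⟩
  · have hst : c.ι.app i '' s.1 = c.ι.app i '' t.1 := congrArg Subtype.val h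
    obtain ⟨k, f, hf⟩ := exists_image_subset_image hc s.2 hst.subset
    obtain ⟨l, g, hg⟩ := exists_image_subset_image hc t.2 hst.superset
    refine ⟨IsFiltered.coeq (f ≫ IsFiltered.leftToMax k l) (g ≫ IsFiltered.rightToMax k l),
      (f ≫ IsFiltered.leftToMax k l) ≫ IsFiltered.coeqHom _ _, Subtype.ext ?_⟩
    refine Set.Subset.antisymm ?_ ?_
    · rintro _ ⟨x, hx, rfl⟩
      obtain ⟨y, hy, hxy⟩ := hf ⟨x, hx, rfl⟩
      exact ⟨y, hy, by simp [hxy]⟩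
    · rw [IsFiltered.coeq_condition]
      rintro _ ⟨x, hx, rfl⟩
      obtain ⟨y, hy, hxy⟩ := hg ⟨x, hx, rfl⟩
      exact ⟨y, hy, by simp [hxy]⟩

end finitePowerset

/-! ### Algebras as maps into continuation monads -/

section continuation

/-- The continuation monad with answer type `B`. -/
def contMonad (B : Type u) : CategoryTheory.Monad (Type u) where
  obj X := (X → B) → B
  map f := TypeCat.ofHom fun Φ k => Φ (fun x => k (f x))
  η := { app := fun X => TypeCat.ofHom fun x k => k x }
  μ := { app := fun X => TypeCat.ofHom fun (Ψ : (((X → B) → B) → B) → B) k => Ψ fun φ => φ k }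

variable {B : Type u}

/-- The natural transformation into the continuation monad classifying an algebra structure. -/
def contNatTrans {H : Type u ⥤ Type u} (b : H.obj B → B) : H ⟶ (contMonad B).toFunctor where
  app X := TypeCat.ofHom fun z k => b (fmap H k z)
  naturality X Y f := by
    ext z
    change (fun k => b (fmap H k (fmap H f z))) = fun k => b (fmap H (fun x => k (f x)) z)
    simp only [fmap_fmap]
    rfl

/-- The monad morphism into the continuation monad classifying an Eilenberg–Moore algebra. -/
def contMonadHom {M : CategoryTheory.Monad (Type u)} {b : M.obj B → B} (hb : IsMonadAlg M b) :
    M ⟶ contMonad B where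
  toNatTrans := contNatTrans b
  app_η X := by
    ext x
    change (fun k => b (fmap M.toFunctor k (M.η.app X x))) = fun k => k x
    simp only [eta_fmap, hb.1]
  app_μ X := by
    ext z
    change (fun k => b (fmap M.toFunctor k (M.μ.app X z))) = fun k =>
      b (fmap M.toFunctor (fun φ : (X → B) → B => φ k)
        (fmap M.toFunctor (fun w k => b (fmap M.toFunctor k w)) z))
    funext k
    rw [← mu_fmap, hb.2, fmap_fmap, fmap_fmap]
    rfl

/-- A monad morphism from `R` into the continuation monad that extends an algebra structure along
`i` yields a homomorphism out of `R X` with prescribed values on the generators. -/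
theorem exists_isAlgHom_of_contMonad {H : Type u ⥤ Type u} {R : CategoryTheory.Monad (Type u)}
    (i : H ⟶ R.toFunctor) (b : H.obj B → B) (f : R ⟶ contMonad B)
    (hf : i ≫ (monadToFunctor (Type u)).map f = contNatTrans b) {X : Type u} (x : X → B) :
    IsAlgHom (inducedStr i X) b (fun t => (f.app X t : (X → B) → B) x) := fun z => by
  have hi : ∀ {Y : Type u} (w : H.obj Y) (k : Y → B),
      (f.app Y (i.app Y w) : (Y → B) → B) k = b (fmap H k w) := fun {Y} w k =>
    congrFun (ConcreteCategory.congr_hom (NatTrans.congr_app hf Y) w) k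
  have h := congrFun (monadHom_mu f (i.app (R.obj X) z)) x
  rw [← app_fmap] at h
  exact h.trans ((hi (fmap H (f.app X) z) (fun φ : (X → B) → B => φ x)).trans
    (congrArg b (fmap_fmap H (fun φ : (X → B) → B => φ x) (f.app X) z)))

theorem contMonad_app_eta {R : CategoryTheory.Monad (Type u)} (f : R ⟶ contMonad B) {X : Type u}
    (x : X → B) (t : X) : (f.app X (R.η.app X t) : (X → B) → B) x = x t :=
  congrFun (monadHom_eta f t) x

end continuation

/-! ### Transfinite coding when prefixed points are missing -/

section transfinite

/-- The initial segments of `X ⊕ D`, for a well-ordered `D`, that contain all of `X`. -/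
def initialSegment (X : Type u) {D : Type u} [LinearOrder D] (d : D) : Set (X ⊕ D) :=
  {c | ∀ d', c = Sum.inr d' → d' < d}

theorem inl_mem_initialSegment {X D : Type u} [LinearOrder D] (x : X) (d : D) :
    (Sum.inl x : X ⊕ D) ∈ initialSegment X d := fun _ h => by cases h

theorem inr_mem_initialSegment {X D : Type u} [LinearOrder D] {d' d : D} (h : d' < d) :
    (Sum.inr d' : X ⊕ D) ∈ initialSegment X d := fun _ h' => Sum.inr_injective h' ▸ h

variable (S : CategoryTheory.Monad (Type u))

/-- A counting argument: otherwise units and earlier choices exhaust `S G` for the stage `G = X +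
{d' < d}`, so `S G` is no larger than the infinite set `G`, and `X ⊕ S G` embeds into `G`. -/
theorem exists_mem_range_fmap_initialSegment {X : Type u} [Infinite X]
    (hX : ∀ (A : Type u) (j : X ⊕ S.obj A → A), ¬ Function.Injective j)
    {D : Type u} [LinearOrder D] (d : D) (prev : ∀ d', d' < d → S.obj (X ⊕ D)) :
    ∃ w : S.obj (X ⊕ D), w ∈ Set.range
        (fmap S.toFunctor (Subtype.val : initialSegment X d → X ⊕ D)) ∧
      (∀ c, w ≠ S.η.app (X ⊕ D) c) ∧ ∀ d' (h : d' < d), w ≠ prev d' h := by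
  by_contra! hcon
  let G : Set (X ⊕ D) := initialSegment X d
  obtain ⟨x₀⟩ : Nonempty X := inferInstance
  have hinl : Function.Injective (fun x : X => (⟨Sum.inl x, inl_mem_initialSegment x d⟩ : G)) :=
    fun x y h => Sum.inl_injective (Subtype.mk.inj h)
  have : Nonempty G := ⟨⟨_, inl_mem_initialSegment x₀ d⟩⟩
  have : Infinite G := Infinite.of_injective _ hinl
  have hG := Cardinal.aleph0_le_mk G
  let r : X ⊕ D → G := Function.invFun Subtype.val
  have hr : r ∘ (Subtype.val : G → X ⊕ D) = id := Function.invFun_comp Subtype.val_injective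
  let φ : G ⊕ {d' // d' < d} → S.obj G :=
    Sum.elim (S.η.app G) (fun d' => fmap S.toFunctor r (prev d'.1 d'.2))
  have hφ : Function.Surjective φ := by
    intro z
    have hz : fmap S.toFunctor r (fmap S.toFunctor Subtype.val z) = z := by
      rw [fmap_fmap, hr, fmap_id]
    by_cases h : ∀ c, fmap S.toFunctor (Subtype.val : G → X ⊕ D) z ≠ S.η.app (X ⊕ D) c
    · obtain ⟨d', hd', h'⟩ := hcon _ ⟨z, rfl⟩ h
      refine ⟨Sum.inr ⟨d', hd'⟩, ?_⟩
      change fmap S.toFunctor r (prev d' hd') = z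
      rw [← h', hz]
    · push Not at h
      obtain ⟨c, hc⟩ := h
      exact ⟨Sum.inl (r c), (eta_fmap S r c).symm.trans ((congrArg _ hc.symm).trans hz)⟩
  have hD : Cardinal.mk {d' // d' < d} ≤ Cardinal.mk G := Cardinal.mk_le_of_injective
    (f := fun d' => (⟨Sum.inr d'.1, inr_mem_initialSegment d'.2⟩ : G))
    fun a b h => Subtype.ext (Sum.inr_injective (Subtype.mk.inj h))
  have h : Cardinal.mk (X ⊕ S.obj G) ≤ Cardinal.mk G := by
    rw [Cardinal.mk_sum, Cardinal.lift_id, Cardinal.lift_id]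
    refine Cardinal.add_le_of_le hG (Cardinal.mk_le_of_injective hinl)
      ((Cardinal.mk_le_of_surjective hφ).trans ?_)
    rw [Cardinal.mk_sum, Cardinal.lift_id, Cardinal.lift_id]
    exact Cardinal.add_le_of_le hG le_rfl hD
  obtain ⟨j⟩ := h
  exact hX G j j.injective

/-- If `S` has no prefixed points above `X`, then every well-ordered `D` can be coded injectively
by elements `q d` of `S (X ⊕ D)`, none of them a unit, each supported by the elements before `d`. -/
theorem exists_coding {X : Type u} [Infinite X]
    (hX : ∀ (A : Type u) (j : X ⊕ S.obj A → A), ¬ Function.Injective j)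
    (D : Type u) [LinearOrder D] [WellFoundedLT D] :
    ∃ q : D → S.obj (X ⊕ D), Function.Injective q ∧
      (∀ d, q d ∈ Set.range (fmap S.toFunctor (Subtype.val : initialSegment X d → X ⊕ D))) ∧
      ∀ d c, q d ≠ S.η.app (X ⊕ D) c := by
  let step := exists_mem_range_fmap_initialSegment S hX (D := D)
  let q : D → S.obj (X ⊕ D) := wellFounded_lt.fix fun d prev => (step d prev).choose
  have hq : ∀ d, q d = (step d fun d' _ => q d').choose := fun d =>
    wellFounded_lt.fix_eq (fun d prev => (step d prev).choose) d
  have hspec : ∀ d, _ := fun d => (step d fun d' _ => q d').choose_spec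
  simp only [← hq] at hspec
  refine ⟨q, fun d d' h => ?_, fun d => (hspec d).1, fun d => (hspec d).2.1⟩
  rcases lt_trichotomy d d' with hd | hd | hd
  · exact ((hspec d').2.2 d hd h.symm).elim
  · exact hd
  · exact ((hspec d).2.2 d' hd h).elim

/-- To produce large prefixed points it suffices to do so above infinite sets. -/
theorem hasLargePrefixedPoints_of_infinite {H : Type u ⥤ Type u}
    (h : ∀ X : Type u, Infinite X →
      ¬ ∀ (A : Type u) (j : X ⊕ H.obj A → A), ¬ Function.Injective j) :
    HasLargePrefixedPoints H := fun Y => by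
  have := h (Y ⊕ ULift.{u} ℕ) inferInstance
  push Not at this
  obtain ⟨A, j, hj⟩ := this
  exact ⟨A, j ∘ Sum.map Sum.inl id, hj.comp (Sum.inl_injective.sumMap Function.injective_id)⟩

theorem HasFreeMonad.hasLargePrefixedPoints (hS : HasFreeMonad S.toFunctor) :
    HasLargePrefixedPoints S.toFunctor := by
  classical
  refine hasLargePrefixedPoints_of_infinite fun X _ hX => ?_
  obtain ⟨F, γ, hF⟩ := hS
  -- By Cantor, the power set of `F X` does not embed into `F X`.
  obtain ⟨D, hD⟩ : ∃ D : Type u, ∀ g : D → F.obj X, ¬ Function.Injective g :=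
    ⟨Set (F.obj X), Function.cantor_injective⟩
  obtain ⟨_, _⟩ := exists_wellFoundedLT D
  obtain ⟨q, hq, hq_seg, -⟩ := exists_coding S hX D
  obtain ⟨x₀⟩ : Nonempty X := inferInstance
  -- This structure decodes `q d` to `d`; its values elsewhere are irrelevant.
  let σ : S.obj (X ⊕ D) → X ⊕ D := Function.extend q Sum.inr fun _ => Sum.inl x₀
  have hσ : ∀ d, σ (q d) = Sum.inr d := fun d => hq.extend_apply _ _ d
  obtain ⟨f, hf, -⟩ := hF (contMonad (X ⊕ D)) (contNatTrans σ)
  have hh := (exists_isAlgHom_of_contMonad γ σ f hf (Sum.inl : X → X ⊕ D)).isSubalgebra_range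
  have hinl : ∀ x : X, (Sum.inl x : X ⊕ D) ∈ Set.range
      fun t => (f.app X t : (X → X ⊕ D) → X ⊕ D) Sum.inl := fun x =>
    ⟨_, contMonad_app_eta f _ x⟩
  -- `q d` is supported by `X` and the earlier elements of `D`, already in the range, so applying
  -- `σ` puts `d` there.
  have hinr : ∀ d : D, (Sum.inr d : X ⊕ D) ∈ Set.range
      fun t => (f.app X t : (X → X ⊕ D) → X ⊕ D) Sum.inl := fun d => by
    induction d using WellFoundedLT.induction with
    | _ d ih =>
      obtain ⟨z, hz⟩ := hq_seg d
      have := hh.mem_of_forall_mem Subtype.val (fun c : initialSegment X d => ?_) z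
      · rwa [hz, hσ] at this
      · rcases c with ⟨x | d', hc⟩
        · exact hinl x
        · exact ih d' (hc d' rfl)
  choose t ht using hinr
  exact hD t fun d d' hdd => Sum.inr_injective (by rw [← ht d, ← ht d', hdd])

end transfinite

/-! ### Semilattices with prescribed joins -/

section semilattice

/-- A partial order with joins of finite sets is an algebra for the finite power-set monad. -/
theorem exists_isMonadAlg_finitePowersetMonad {L : Type u} [PartialOrder L]
    (h : ∀ s : Set L, s.Finite → ∃ x, IsLUB s x) :
    ∃ a : finitePowersetMonad.obj L → L, IsMonadAlg finitePowersetMonad a ∧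
      ∀ s : {s : Set L // s.Finite}, IsLUB s.1 (a s) := by
  choose a ha using h
  refine ⟨fun s : {s : Set L // s.Finite} => a s.1 s.2, ⟨fun x => ?_, fun A => ?_⟩,
    fun s => ha s.1 s.2⟩
  · exact (ha {x} (Set.finite_singleton x)).unique isLUB_singleton
  · obtain ⟨A, hA⟩ : {t : Set {s : Set L // s.Finite} // t.Finite} := A
    have h1 := ha (⋃ s ∈ A, s.1) (hA.biUnion fun s _ => s.2)
    have h2 := ha ((fun s : {s : Set L // s.Finite} => a s.1 s.2) '' A) (hA.image _)
    refine h1.unique ⟨fun x hx => ?_, fun y hy => h2.2 ?_⟩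
    · simp only [Set.mem_iUnion] at hx
      obtain ⟨s, hs, hx⟩ := hx
      exact ((ha s.1 s.2).1 hx).trans (h2.1 ⟨s, hs, rfl⟩)
    · rintro _ ⟨s, hs, rfl⟩
      exact (ha s.1 s.2).2 fun x hx => hy (Set.mem_biUnion hs hx)

theorem exists_isLUB_of_finite {L : Type u} [PartialOrder L] (bot : L) (hbot : ∀ x, bot ≤ x)
    (h : ∀ x y : L, ∃ z, IsLUB {x, y} z) (s : Set L) (hs : s.Finite) : ∃ x, IsLUB s x := by
  induction s, hs using Set.Finite.induction_on with
  | empty => exact ⟨bot, by simp [isLUB_empty_iff, IsBot, hbot]⟩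
  | @insert a s _ _ ih =>
    obtain ⟨x, hx⟩ := ih
    obtain ⟨z, hz⟩ := h a x
    refine ⟨z, ?_, fun y hy => hz.2 ?_⟩
    · rintro y (rfl | hy)
      · exact hz.1 (Or.inl rfl)
      · exact (hx.1 hy).trans (hz.1 (Or.inr rfl))
    · rintro _ (rfl | rfl)
      · exact hy (Set.mem_insert _ _)
      · exact hx.2 fun w hw => hy (Set.mem_insert_of_mem _ hw)

/-- On a set with distinct elements `bot`, `top`, `k`, `q d`, `e d` there is a semilattice
structure in which `e d` is the join of `k` and `q d`. -/
theorem exists_semilattice {L D : Type u} {bot top k : L} {q e : D → L} (hq : Function.Injective q)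
    (he : Function.Injective e) (hqe : ∀ d d', q d ≠ e d') (hbt : bot ≠ top) (hbk : bot ≠ k)
    (htk : top ≠ k) (hbq : ∀ d, q d ≠ bot) (htq : ∀ d, q d ≠ top) (hkq : ∀ d, q d ≠ k)
    (hbe : ∀ d, e d ≠ bot) (hte : ∀ d, e d ≠ top) (hke : ∀ d, e d ≠ k) :
    ∃ a : finitePowersetMonad.obj L → L, IsMonadAlg finitePowersetMonad a ∧
      ∀ d, a ⟨{k, q d}, Set.toFinite _⟩ = e d := by
  -- Besides the bounds `bot` and `top`, the only strict relations are `k, q d < e d`. As `q` is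
  -- injective, `e d` is the only upper bound of `k` and `q d` below `top`.
  let _ : PartialOrder L :=
    { le := fun x y => x = y ∨ x = bot ∨ y = top ∨ ∃ d, y = e d ∧ (x = k ∨ x = q d)
      le_refl := fun x => Or.inl rfl
      le_trans := by grind
      le_antisymm := by grind }
  have hle : ∀ {x y : L}, x ≤ y ↔ x = y ∨ x = bot ∨ y = top ∨
    ∃ d, y = e d ∧ (x = k ∨ x = q d) := Iff.rfl
  have hlub : ∀ d, IsLUB {k, q d} (e d) := fun d => by
    refine ⟨?_, fun y hy => ?_⟩
    · rintro _ (rfl | rfl)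
      · exact hle.2 (by grind)
      · exact hle.2 (by grind)
    · have h1 := hle.1 (hy (Or.inl rfl))
      have h2 := hle.1 (hy (Or.inr rfl))
      exact hle.2 (by grind)
  have hpair : ∀ x y : L, ∃ z, IsLUB {x, y} z := by
    intro x y
    by_cases hxy : x ≤ y
    · exact ⟨y, by simpa using hxy, fun z hz => hz (Or.inr rfl)⟩
    by_cases hyx : y ≤ x
    · exact ⟨x, by simpa using hyx, fun z hz => hz (Or.inl rfl)⟩
    by_cases h : ∃ d, (x = k ∧ y = q d) ∨ (y = k ∧ x = q d)
    · obtain ⟨d, ⟨rfl, rfl⟩ | ⟨rfl, rfl⟩⟩ := h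
      · exact ⟨e d, hlub d⟩
      · exact ⟨e d, Set.pair_comm _ _ ▸ hlub d⟩
    -- Any other incomparable pair has no upper bound but `top`.
    · refine ⟨top, fun z _ => hle.2 (by grind), fun z hz => ?_⟩
      have h1 := hle.1 (hz (Or.inl rfl))
      have h2 := hle.1 (hz (Or.inr rfl))
      rw [hle] at hxy hyx ⊢
      grind
  obtain ⟨a, ha, ha'⟩ := exists_isMonadAlg_finitePowersetMonad
    (exists_isLUB_of_finite bot (fun x => hle.2 (Or.inr (Or.inl rfl))) hpair)
  exact ⟨a, ha, fun d => (ha' ⟨{k, q d}, Set.toFinite _⟩).unique (hlub d)⟩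

end semilattice

/-! ### Coproduct with the finite power-set monad -/

section powersetCoproduct

variable (S : CategoryTheory.Monad (Type u))

/-- A monad with a non-injective unit has only subsingletons as values. -/
theorem subsingleton_obj_of_not_injective_eta {A : Type u}
    (h : ¬ Function.Injective (S.η.app A)) (Z : Type u) : Subsingleton (S.obj Z) := by
  classical
  obtain ⟨x, y, hxy, hne⟩ : ∃ x y : A, S.η.app A x = S.η.app A y ∧ x ≠ y := by
    by_contra! hc
    exact h hc
  refine ⟨fun w w' => ?_⟩
  -- Extending `g` along the unit forces `g x = g y`, so any two elements of `S Z` agree.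
  let g : A → S.obj Z := fun t => if t = x then w else w'
  have hw : g x = w := if_pos rfl
  have hw' : g y = w' := if_neg hne.symm
  have hg : S.η.app _ (g x) = S.η.app _ (g y) :=
    (eta_fmap S g x).symm.trans ((congrArg _ hxy).trans (eta_fmap S g y))
  rw [← mu_eta S w, ← mu_eta S w', ← hw, ← hw', hg]

theorem hasLargePrefixedPoints_of_hasBinaryCoproduct
    (hS : HasBinaryCoproduct S finitePowersetMonad) :
    HasLargePrefixedPoints S.toFunctor := by
  classical
  refine hasLargePrefixedPoints_of_infinite fun X _ hX => ?_
  -- A non-injective unit would make `S X` a subsingleton, and then `X ⊕ S X` embeds into the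
  -- infinite `X`.
  have hη : ∀ A, Function.Injective (S.η.app A) := by
    by_contra! h
    obtain ⟨A, hA⟩ := h
    have := subsingleton_obj_of_not_injective_eta S hA
    obtain ⟨x₀⟩ : Nonempty X := inferInstance
    obtain ⟨g⟩ : Nonempty (X ⊕ S.obj X ↪ X) := by
      change Cardinal.mk (X ⊕ S.obj X) ≤ Cardinal.mk X
      rw [Cardinal.mk_sum, Cardinal.lift_id, Cardinal.lift_id]
      exact Cardinal.add_le_of_le (Cardinal.aleph0_le_mk X) le_rfl
        (Cardinal.mk_le_of_injective (f := fun _ => x₀) fun a b _ => Subsingleton.elim a b)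
    exact hX X g g.injective
  let R : CategoryTheory.Monad (Type u) := S ⨿ finitePowersetMonad
  obtain ⟨D, hD⟩ : ∃ D : Type u, ∀ g : D → R.obj X, ¬ Function.Injective g :=
    ⟨Set (R.obj X), Function.cantor_injective⟩
  obtain ⟨_, _⟩ := exists_wellFoundedLT D
  obtain ⟨q, hq, hq_seg, hq_η⟩ := exists_coding S hX D
  let L := S.obj (X ⊕ D)
  let η : X ⊕ D → L := S.η.app (X ⊕ D)
  have hη : Function.Injective η := hη _
  let ι : ℕ ↪ X := Infinite.natEmbedding X
  have hι : ∀ m n, m ≠ n → η (Sum.inl (ι m)) ≠ η (Sum.inl (ι n)) := fun m n hmn h =>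
    hmn (ι.injective (Sum.inl_injective (hη h)))
  have hιe : ∀ n d, η (Sum.inr d) ≠ η (Sum.inl (ι n)) := fun n d h => by cases hη h
  -- The constants `bot`, `top`, `k` are units at three distinct points of `X`; since no `q d` is a
  -- unit, all the required elements are distinct.
  obtain ⟨a, ha, hae⟩ := exists_semilattice (bot := η (Sum.inl (ι 0))) (top := η (Sum.inl (ι 1)))
    (k := η (Sum.inl (ι 2))) (e := fun d => η (Sum.inr d)) hq (hη.comp Sum.inr_injective)
    (fun d d' => hq_η d _) (hι _ _ (by decide)) (hι _ _ (by decide)) (hι _ _ (by decide))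
    (fun d => hq_η d _) (fun d => hq_η d _) (fun d => hq_η d _) (hιe 0) (hιe 1) (hιe 2)
  have hμ : IsMonadAlg S (S.μ.app (X ⊕ D) : S.obj L → L) :=
    ⟨mu_eta S, fun z => (mu_assoc S z).symm⟩
  let f : R ⟶ contMonad L := coprod.desc (contMonadHom hμ) (contMonadHom ha)
  let h : R.obj X → L := fun t => (f.app X t : (X → L) → L) fun x => η (Sum.inl x)
  have hS : IsSubalgebra (S.μ.app (X ⊕ D) : S.obj L → L) (Set.range h) :=
    (exists_isAlgHom_of_contMonad ((monadToFunctor (Type u)).map coprod.inl) _ f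
      (((monadToFunctor (Type u)).map_comp _ _).symm.trans (congrArg _ (coprod.inl_desc _ _)))
      _).isSubalgebra_range
  have hP : IsSubalgebra (H := finitePowersetMonad.toFunctor) a (Set.range h) :=
    (exists_isAlgHom_of_contMonad ((monadToFunctor (Type u)).map coprod.inr) _ f
      (((monadToFunctor (Type u)).map_comp _ _).symm.trans (congrArg _ (coprod.inr_desc _ _)))
      _).isSubalgebra_range
  have hinl : ∀ x, η (Sum.inl x) ∈ Set.range h := fun x => ⟨_, contMonad_app_eta f _ x⟩
  -- The two structures alternate: multiplication of `S` builds `q d` from earlier units, and the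
  -- join with `k` turns `q d` into the unit at `d`.
  have hmem : ∀ d, q d ∈ Set.range h ∧ η (Sum.inr d) ∈ Set.range h := fun d => by
    induction d using WellFoundedLT.induction with
    | _ d ih =>
      have hqd : q d ∈ Set.range h := by
        obtain ⟨z, hz⟩ := hq_seg d
        have := hS.mem_of_forall_mem (fun c => η c.1) (fun c : initialSegment X d => ?_) z
        · have h' : (fun c : initialSegment X d => η c.1) = S.η.app (X ⊕ D) ∘ Subtype.val := rfl
          rwa [h', ← fmap_fmap, mu_fmap_eta, hz] at this
        · rcases c with ⟨x | d', hc⟩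
          · exact hinl x
          · exact (ih d' (hc d' rfl)).2
      refine ⟨hqd, ?_⟩
      let p : {s : Set (Set.range h) // s.Finite} :=
        ⟨{⟨_, hinl (ι 2)⟩, ⟨_, hqd⟩}, Set.toFinite _⟩
      have hp : fmap finitePowersetMonad.toFunctor (Subtype.val : Set.range h → L) p =
          (⟨{η (Sum.inl (ι 2)), q d}, Set.toFinite _⟩ : {s : Set L // s.Finite}) :=
        Subtype.ext (Set.image_pair _ _ _)
      have := hP p
      rwa [hp, hae d] at this
  choose t ht using fun d => (hmem d).1
  exact hD t fun d d' hdd => hq (by rw [← ht d, ← ht d', hdd])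

end powersetCoproduct

theorem corollaryC5 (S : CategoryTheory.Monad (Type u)) :
    ((∀ T : CategoryTheory.Monad (Type u), IsFinitaryMonad T → HasBinaryCoproduct S T) ↔
      HasFreeMonad S.toFunctor) ∧
    (HasBinaryCoproduct S finitePowersetMonad ↔ HasFreeMonad S.toFunctor) := by
  have h1 : HasFreeMonad S.toFunctor → ∀ T : CategoryTheory.Monad (Type u), IsFinitaryMonad T →
      HasBinaryCoproduct S T := fun h T hT => by
    have : PreservesFilteredColimits T.toFunctor := hT
    exact hasBinaryCoproduct_of_hasLargePrefixedPoints S T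
      ((HasFreeMonad.hasLargePrefixedPoints S h).sumFunctor_of_preservesFilteredColimits _)
  have h2 : HasBinaryCoproduct S finitePowersetMonad → HasFreeMonad S.toFunctor := fun h =>
    (hasLargePrefixedPoints_of_hasBinaryCoproduct S h).hasFreeMonad
  exact ⟨⟨fun h => h2 (h _ isFinitaryMonad_finitePowersetMonad), h1⟩, h2,
    fun h => h1 h _ isFinitaryMonad_finitePowersetMonad⟩
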